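/- **Theorem (multivariate martingale central limit theorem).** Let $(\Omega,\mathcal F,P)$ be a probability space, let $d\ge 0$ be an integer, and for each $n$ let $(\mathcal F_{n,k})_{k\ge 0}$ be a filtration on it (no relation between filtrations with different $n$ is required; a single filtration $\mathcal F_{n,k}=\mathcal F_k$ is a special case). Let $(X_{n,k})_{1\le k\le n}$ be a square-integrable $\mathbb R^d$-valued martingale difference array, that is, each $X_{n,k}$ is $\mathcal F_{n,k}$-measurable, $E\|X_{n,k}\|^2<\infty$ ($\|\cdot\|$ the Euclidean norm), and $E[X_{n,k}\mid\mathcal F_{n,k-1}]=0$ almost surely. Suppose that the conditional Lindeberg condition holds: for every $\epsilon>0$, $$\sum_{k=1}^n E\big[\|X_{n,k}\|^2\,\mathbb 1_{\{\|X_{n,k}\|>\epsilon\}}\,\big|\,\mathcal F_{n,k-1}\big]\xrightarrow{P}0\qquad(n\to\infty).$$ Suppose also that, for some deterministic real $d\times d$ matrix $\Upsilon$, entrywise, $$\sum_{k=1}^n E\big[X_{n,k}X_{n,k}^\top\,\big|\,\mathcal F_{n,k-1}\big]\xrightarrow{P}\Upsilon\qquad(n\to\infty).$$ Then $\Upsilon$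 is symmetric positive semidefinite, and $$\sum_{k=1}^n X_{n,k}\xrightarrow{\mathcal D}N(0,\Upsilon)\qquad(n\to\infty),$$ where $N(0,\Upsilon)$ is the (possibly degenerate) centered Gaussian law on $\mathbb R^d$ with covariance matrix $\Upsilon$. -/

import Mathlib

open MeasureTheory ProbabilityTheory Filter

/-- `(X n k)`, `1 ≤ k ≤ n`, is an array of `ℝᵈ`-valued martingale differences: in each row `n`,
with respect to the filtration `F n`, every `X n k` is `F n k`-measurable, integrable, and
satisfies `E[X n k | F n (k - 1)] = 0` almost surely. Entries outside `1 ≤ k ≤ n` are irrelevant.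
A single filtration for all rows is the case of a constant `F`. -/
structure IsMartingaleDifferenceArray {Ω : Type*} {m : MeasurableSpace Ω} {d : ℕ}
    (μ : Measure Ω) (F : ℕ → Filtration ℕ m) (X : ℕ → ℕ → Ω → EuclideanSpace ℝ (Fin d)) :
    Prop where
  adapted : ∀ n k, 1 ≤ k → k ≤ n → StronglyMeasurable[F n k] (X n k)
  integrable : ∀ n k, 1 ≤ k → k ≤ n → Integrable (X n k) μ
  condExp_eq_zero : ∀ n k, 1 ≤ k → k ≤ n → μ[X n k | F n (k - 1)] =ᵐ[μ] 0

/-- The random matrix `E[Y Yᵀ | m']`; the conditional expectation of a random matrix is taken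
entry by entry. -/
noncomputable def condSecondMoment {Ω : Type*} {m : MeasurableSpace Ω} {d : ℕ}
    (μ : Measure Ω) (m' : MeasurableSpace Ω) (Y : Ω → EuclideanSpace ℝ (Fin d)) :
    Ω → Matrix (Fin d) (Fin d) ℝ :=
  fun ω => Matrix.of fun i j =>
    (μ[fun ω' => Matrix.vecMulVec (Y ω').ofLp (Y ω').ofLp i j | m']) ω

/-- The conditional Lindeberg condition: for every `ε > 0`,
`∑_{k=1}^n E[‖X n k‖² 1_{‖X n k‖ > ε} | F n (k - 1)] → 0` in probability. -/
def ConditionalLindeberg {Ω : Type*} {m : MeasurableSpace Ω} {d : ℕ}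
    (μ : Measure Ω) (F : ℕ → Filtration ℕ m) (X : ℕ → ℕ → Ω → EuclideanSpace ℝ (Fin d)) :
    Prop :=
  ∀ ε : ℝ, 0 < ε →
    TendstoInMeasure μ
      (fun n ω => ∑ k ∈ Finset.Icc 1 n,
        (μ[{ω' | ε < ‖X n k ω'‖}.indicator (fun ω' => ‖X n k ω'‖ ^ 2) | F n (k - 1)]) ω)
      atTop (fun _ => (0 : ℝ))

/-- Convergence in probability of random matrices to a constant matrix, i.e. convergence in
probability of every entry. -/
def MatrixTendstoInProbability {Ω : Type*} {m : MeasurableSpace Ω} {d : ℕ}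
    (μ : Measure Ω) (A : ℕ → Ω → Matrix (Fin d) (Fin d) ℝ) (B : Matrix (Fin d) (Fin d) ℝ) :
    Prop :=
  ∀ i j, TendstoInMeasure μ (fun n ω => A n ω i j) atTop (fun _ => B i j)

/-! Pairing with a fixed `t` reduces the claim to scalars: by Lévy's continuity theorem it suffices
that E exp(i⟨S, t⟩) → exp(-v/2) with v = tᵀΥt, and both hypotheses pass to the differences ⟨X, t⟩.

For scalar differences y with conditional variances s, and sums S and U of these, exp(iS + U/2) is
nearly a martingale: given the past, exp(iy) averages to 1 - s/2 up to a Lindeberg error, and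
exp(-s/2) has the same expansion. Hence E exp(iS + U/2) is close to 1 as long as U is bounded
(`norm_integral_cexp_sum_sub_one_le`).

Boundedness is forced by stopping: a term is kept only while the conditional variances up to and
including its own sum to at most v + 1. This event belongs to the past of the term, so the kept
terms are still martingale differences. As the full sum of conditional variances tends to v in
probability, stopping is asymptotically invisible and exp(U/2) can be traded for exp(v/2)
(`norm_integral_cexp_sum_sub_exp_le`). The hypotheses hold only in probability, so apart from a term
of order ε the errors are expectations of capped quantities, to which bounded convergence applies.
-/

/-! ### Elementary estimates for exponentials. -/

/-- Second-order Taylor bound for `exp (i y)`, in a form suited to Lindeberg conditions. -/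
theorem norm_cexp_I_mul_sub_taylor_le {ε : ℝ} (hε : 0 < ε) (hε1 : ε ≤ 1) (y : ℝ) :
    ‖Complex.exp (Complex.I * y) - 1 - Complex.I * y + (y : ℂ) ^ 2 / 2‖
      ≤ ε * y ^ 2 + 4 * {z : ℝ | ε < |z|}.indicator (fun z => z ^ 2) y := by
  have hsmall : |y| ≤ 1 →
      ‖Complex.exp (Complex.I * y) - 1 - Complex.I * y + (y : ℂ) ^ 2 / 2‖ ≤ |y| * y ^ 2 := by
    intro h
    have h1 := Complex.exp_bound (x := Complex.I * y) (by simpa using h) (n := 3) (by norm_num)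
    have e : Complex.exp (Complex.I * y) - 1 - Complex.I * y + (y : ℂ) ^ 2 / 2
        = Complex.exp (Complex.I * y) - ∑ m ∈ Finset.range 3, (Complex.I * y) ^ m / m.factorial := by
      simp [Finset.sum_range_succ, Nat.factorial, mul_pow]
      ring
    rw [e]
    refine h1.trans ?_
    have h2 : ‖Complex.I * (y : ℂ)‖ = |y| := by simp
    have h4 : |y| * y ^ 2 = |y| ^ 3 := by rw [← sq_abs y]; ring
    rw [h2, h4]
    norm_num [Nat.factorial]
    linarith [pow_nonneg (abs_nonneg y) 3]
  by_cases hy : |y| ≤ ε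
  · rw [Set.indicator_of_notMem (by simpa using hy)]
    refine (hsmall (hy.trans hε1)).trans ?_
    nlinarith [sq_nonneg y]
  · push Not at hy
    rw [Set.indicator_of_mem (by simpa using hy)]
    by_cases h1 : |y| ≤ 1
    · refine (hsmall h1).trans ?_
      nlinarith [sq_nonneg y]
    · push Not at h1
      -- For |y| > 1 the Taylor bound is replaced by the triangle inequality; 2 + |y| + y²/2 is
      -- absorbed by 4y².
      have h3 : ‖Complex.exp (Complex.I * y) - 1 - Complex.I * y + (y : ℂ) ^ 2 / 2‖
          ≤ 1 + 1 + |y| + y ^ 2 / 2 := by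
        refine (norm_add_le _ _).trans (add_le_add ((norm_sub_le _ _).trans (add_le_add
          ((norm_sub_le _ _).trans (add_le_add ?_ ?_)) ?_)) ?_)
        · rw [Complex.norm_exp_I_mul_ofReal]
        · simp
        · simp
        · simp
      refine h3.trans ?_
      rw [← sq_abs y]
      nlinarith [sq_nonneg |y|]

theorem abs_exp_neg_sub_taylor_le {x : ℝ} (hx : 0 ≤ x) : |Real.exp (-x) - 1 + x| ≤ x ^ 2 := by
  by_cases h : x ≤ 1
  · have := Real.norm_exp_sub_one_sub_id_le (x := -x) (by simpa [abs_of_nonneg hx] using h)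
    simpa using this
  · have h1 := Real.add_one_le_exp (-x)
    have h2 : Real.exp (-x) ≤ 1 := by simpa using hx
    rw [abs_of_nonneg (by linarith)]
    nlinarith

theorem abs_one_sub_exp_le_two_mul {u : ℝ} (hu : u ≤ 1 / 2) : |1 - Real.exp u| ≤ 2 * |u| := by
  have h1 := Real.add_one_le_exp u
  have h2 := Real.add_one_le_exp (-u)
  have h3 : Real.exp u * Real.exp (-u) = 1 := by rw [← Real.exp_add]; simp
  have h4 := Real.exp_pos u
  rcases le_total 0 u with h | h
  · have h5 : Real.exp u ≤ 2 := by nlinarith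
    rw [abs_of_nonneg h, abs_of_nonpos (by linarith)]
    nlinarith
  · rw [abs_of_nonpos h, abs_of_nonneg (by simpa using h)]
    nlinarith

/-! ### One row whose conditional variances have a bounded sum. -/

section Integrals

variable {Ω : Type*} {m : MeasurableSpace Ω} {μ : Measure Ω}

theorem integrable_indicator_sq {y : Ω → ℝ} (hy : MemLp y 2 μ) (ε : ℝ) :
    Integrable ({ω | ε < |y ω|}.indicator (fun ω => y ω ^ 2)) μ :=
  hy.integrable_sq.indicator₀
    (nullMeasurableSet_lt aemeasurable_const hy.aestronglyMeasurable.aemeasurable.norm)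

variable [IsProbabilityMeasure μ]

/-- A bounded `m'`-measurable complex factor only sees the conditional expectation. -/
theorem integral_mul_condExp_of_bound {m' : MeasurableSpace Ω} (hm : m' ≤ m) {W : Ω → ℂ}
    (hW : StronglyMeasurable[m'] W) {C : ℝ} (hC : ∀ ω, ‖W ω‖ ≤ C) {f : Ω → ℝ}
    (hf : Integrable f μ) : ∫ ω, W ω * f ω ∂μ = ∫ ω, W ω * ((μ[f | m']) ω : ℝ) ∂μ := by
  have h := condExp_stronglyMeasurable_bilin_of_bound (μ := μ)
    (ContinuousLinearMap.lsmul ℝ ℝ (E := ℂ)).flip hm hW hf C (ae_of_all _ hC)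
  rw [← integral_condExp hm]
  have e : (fun ω => W ω * (f ω : ℂ))
      = fun ω => (ContinuousLinearMap.lsmul ℝ ℝ (E := ℂ)).flip (W ω) (f ω) := by
    ext ω; simp [mul_comm]
  rw [e]
  refine integral_congr_ae (h.trans (ae_of_all _ fun ω => ?_))
  simp [mul_comm]

/-- Against an `m'`-measurable weight the linear term of exp(iy) vanishes, and -y²/2 cancels the
-s/2 of exp(-s/2), since s is the conditional second moment of y. Only Taylor remainders survive. -/
theorem norm_integral_mul_cexp_sub_exp_le {m' : MeasurableSpace Ω} (hm : m' ≤ m) {W : Ω → ℂ}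
    (hW : StronglyMeasurable[m'] W) {C : ℝ} (hC : ∀ ω, ‖W ω‖ ≤ C) {y s : Ω → ℝ}
    (hy : MemLp y 2 μ) (hy0 : μ[y | m'] =ᵐ[μ] 0) (hs : StronglyMeasurable[m'] s)
    (hsy : s =ᵐ[μ] μ[fun ω => y ω ^ 2 | m']) (hs0 : ∀ ω, 0 ≤ s ω) {K : ℝ} (hsK : ∀ ω, s ω ≤ K)
    {ε : ℝ} (hε : 0 < ε) (hε1 : ε ≤ 1) :
    ‖∫ ω, W ω * (Complex.exp (Complex.I * y ω) - Complex.exp (-(s ω / 2 : ℝ))) ∂μ‖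
      ≤ C * ((ε + ε ^ 2) * ∫ ω, s ω ∂μ
        + (4 + K) * ∫ ω, {ω | ε < |y ω|}.indicator (fun ω => y ω ^ 2) ω ∂μ) := by
  obtain ⟨ω₀⟩ : Nonempty Ω := nonempty_of_isProbabilityMeasure μ
  have hC0 : 0 ≤ C := (norm_nonneg _).trans (hC ω₀)
  have hyi : Integrable y μ := hy.integrable (by norm_num)
  have hy2 : Integrable (fun ω => y ω ^ 2) μ := hy.integrable_sq
  have hsm : StronglyMeasurable[m] s := hs.mono hm
  have hWm : StronglyMeasurable[m] W := hW.mono hm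
  have hsi : Integrable s μ := .of_bound hsm.aestronglyMeasurable K
    (ae_of_all _ fun ω => by rw [Real.norm_of_nonneg (hs0 ω)]; exact hsK ω)
  have hs2 : Integrable (fun ω => s ω ^ 2) μ := by
    refine .of_bound (hsm.pow 2).aestronglyMeasurable (K ^ 2) (ae_of_all _ fun ω => ?_)
    rw [Real.norm_of_nonneg (sq_nonneg _)]
    exact pow_le_pow_left₀ (hs0 ω) (hsK ω) 2
  have hind : Integrable ({ω | ε < |y ω|}.indicator (fun ω => y ω ^ 2)) μ :=
    integrable_indicator_sq hy ε
  have hWmul {f : Ω → ℂ} (hf : Integrable f μ) : Integrable (fun ω => W ω * f ω) μ :=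
    hf.bdd_mul hWm.aestronglyMeasurable (ae_of_all _ hC)
  have hyI : ∫ ω, W ω * (y ω : ℂ) ∂μ = 0 := by
    rw [integral_mul_condExp_of_bound hm hW hC hyi, integral_eq_zero_of_ae]
    filter_upwards [hy0] with ω h
    simp [h]
  have hyS : ∫ ω, W ω * ((y ω ^ 2 : ℝ) : ℂ) ∂μ = ∫ ω, W ω * (s ω : ℂ) ∂μ := by
    rw [integral_mul_condExp_of_bound hm hW hC hy2]
    refine integral_congr_ae ?_
    filter_upwards [hsy] with ω h
    rw [h]
  have hys : ∫ ω, y ω ^ 2 ∂μ = ∫ ω, s ω ∂μ := by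
    rw [integral_congr_ae hsy, integral_condExp hm]
  have hsC : ∀ ω, ‖((s ω : ℝ) : ℂ)‖ ≤ K := fun ω => by
    rw [Complex.norm_real, Real.norm_of_nonneg (hs0 ω)]; exact hsK ω
  have hsC2 : StronglyMeasurable[m'] fun ω => (s ω : ℂ) :=
    Complex.continuous_ofReal.comp_stronglyMeasurable hs
  have hsq : ∫ ω, s ω ^ 2 ∂μ = ∫ ω, s ω * y ω ^ 2 ∂μ := by
    have h := integral_mul_condExp_of_bound (μ := μ) hm hsC2 hsC hy2
    have h' : ∫ ω, (s ω : ℂ) * ((μ[fun ω => y ω ^ 2 | m']) ω : ℝ) ∂μ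
        = ∫ ω, (s ω : ℂ) * (s ω : ℝ) ∂μ := by
      refine integral_congr_ae ?_
      filter_upwards [hsy] with ω h
      rw [h]
    rw [h'] at h
    simp_rw [← Complex.ofReal_mul, integral_complex_ofReal] at h
    simp_rw [sq (s _)]
    exact_mod_cast h.symm
  have hsyi : Integrable (fun ω => s ω * y ω ^ 2) μ :=
    hy2.bdd_mul hsm.aestronglyMeasurable (c := K) (ae_of_all _ fun ω => by
      rw [Real.norm_of_nonneg (hs0 ω)]; exact hsK ω)
  -- One factor s in s² is exchanged for y², which is then split at |y| = ε: s y² is at most ε² s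
  -- below the threshold and K y² above it.
  have hsqle : ∫ ω, s ω ^ 2 ∂μ ≤ ε ^ 2 * ∫ ω, s ω ∂μ
      + K * ∫ ω, {ω | ε < |y ω|}.indicator (fun ω => y ω ^ 2) ω ∂μ := by
    rw [hsq, ← integral_const_mul, ← integral_const_mul,
      ← integral_add (hsi.const_mul _) (hind.const_mul _)]
    refine integral_mono hsyi ((hsi.const_mul _).add (hind.const_mul _)) fun ω => ?_
    by_cases h : ε < |y ω|
    · simp only [Set.indicator, Set.mem_ofPred_eq, h, if_true]
      nlinarith [mul_nonneg (sub_nonneg.2 (hsK ω)) (sq_nonneg (y ω)),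
        mul_nonneg (sq_nonneg ε) (hs0 ω)]
    · simp only [Set.indicator, Set.mem_ofPred_eq, h, if_false]
      have h2 : y ω ^ 2 ≤ ε ^ 2 := by
        rw [← sq_abs]; exact pow_le_pow_left₀ (abs_nonneg _) (not_lt.1 h) 2
      nlinarith [mul_nonneg (hs0 ω) (sub_nonneg.2 h2)]
  have hym := hy.aestronglyMeasurable
  have hyiC : Integrable (fun ω => (y ω : ℂ)) μ := hyi.ofReal
  have hy2C : Integrable (fun ω => ((y ω ^ 2 : ℝ) : ℂ)) μ := hy2.ofReal
  have hsiC : Integrable (fun ω => (s ω : ℂ)) μ := hsi.ofReal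
  have hE : Integrable (fun ω => Complex.exp (Complex.I * y ω)
      - Complex.exp (-(s ω / 2 : ℝ))) μ := by
    refine .of_bound (C := 2) ?_ (ae_of_all _ fun ω => ?_)
    · have h1 := hym.aemeasurable
      have h2 := hsm.measurable
      exact AEMeasurable.aestronglyMeasurable (by fun_prop)
    · refine (norm_sub_le _ _).trans ?_
      rw [Complex.norm_exp_I_mul_ofReal, ← Complex.ofReal_neg, Complex.norm_exp_ofReal]
      have : Real.exp (-(s ω / 2)) ≤ 1 := Real.exp_le_one_iff.2 (by linarith [hs0 ω])
      linarith
  -- The terms added to the difference integrate to zero against `W`; they turn it into the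
  -- remainder of exp(iy) minus that of exp(-s/2).
  set R : Ω → ℂ := fun ω => (Complex.exp (Complex.I * y ω)
      - Complex.exp (-(s ω / 2 : ℝ))) - Complex.I * y ω
        + (1 / 2) * ((y ω ^ 2 : ℝ) : ℂ) - (1 / 2) * (s ω : ℂ) with hR
  have hkey : ∫ ω, W ω * (Complex.exp (Complex.I * y ω) - Complex.exp (-(s ω / 2 : ℝ))) ∂μ
      = ∫ ω, W ω * R ω ∂μ := by
    have e : ∀ ω, W ω * R ω = W ω * (Complex.exp (Complex.I * y ω)
        - Complex.exp (-(s ω / 2 : ℝ))) - Complex.I * (W ω * y ω)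
        + (1 / 2) * (W ω * ((y ω ^ 2 : ℝ) : ℂ)) - (1 / 2) * (W ω * (s ω : ℂ)) := by
      intro ω; simp only [hR]; ring
    simp_rw [e]
    have i1 := hWmul hE
    have i2 := (hWmul hyiC).const_mul Complex.I
    have i3 := (hWmul hy2C).const_mul (1 / 2)
    have i4 := (hWmul hsiC).const_mul (1 / 2)
    have i12 : Integrable (fun ω => W ω * (Complex.exp (Complex.I * y ω)
        - Complex.exp (-(s ω / 2 : ℝ))) - Complex.I * (W ω * y ω)) μ := i1.sub i2
    have i123 : Integrable (fun ω => W ω * (Complex.exp (Complex.I * y ω)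
        - Complex.exp (-(s ω / 2 : ℝ))) - Complex.I * (W ω * y ω)
        + (1 / 2) * (W ω * ((y ω ^ 2 : ℝ) : ℂ))) μ := i12.add i3
    rw [integral_sub i123 i4, integral_add i12 i3, integral_sub i1 i2,
      integral_const_mul, integral_const_mul, integral_const_mul, hyI, hyS]
    ring
  have hRle : ∀ ω, ‖R ω‖ ≤ ε * y ω ^ 2
      + 4 * {ω | ε < |y ω|}.indicator (fun ω => y ω ^ 2) ω + s ω ^ 2 := by
    intro ω
    have e : R ω = (Complex.exp (Complex.I * y ω) - 1 - Complex.I * y ω + (y ω : ℂ) ^ 2 / 2)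
        - ((Real.exp (-(s ω / 2)) - 1 + s ω / 2 : ℝ) : ℂ) := by
      simp only [hR]; push_cast; ring
    rw [e]
    refine (norm_sub_le _ _).trans (add_le_add (norm_cexp_I_mul_sub_taylor_le hε hε1 (y ω)) ?_)
    rw [Complex.norm_real, Real.norm_eq_abs]
    refine (abs_exp_neg_sub_taylor_le (by linarith [hs0 ω])).trans ?_
    nlinarith [sq_nonneg (s ω)]
  have hyi2 : Integrable (fun ω => ε * y ω ^ 2
      + 4 * {ω | ε < |y ω|}.indicator (fun ω => y ω ^ 2) ω) μ :=
    (hy2.const_mul ε).add (hind.const_mul 4)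
  have hbi : Integrable (fun ω => C * (ε * y ω ^ 2
      + 4 * {ω | ε < |y ω|}.indicator (fun ω => y ω ^ 2) ω + s ω ^ 2)) μ :=
    (hyi2.add hs2).const_mul C
  rw [hkey]
  calc ‖∫ ω, W ω * R ω ∂μ‖
      ≤ ∫ ω, C * (ε * y ω ^ 2
          + 4 * {ω | ε < |y ω|}.indicator (fun ω => y ω ^ 2) ω + s ω ^ 2) ∂μ := by
        refine norm_integral_le_of_norm_le hbi (ae_of_all _ fun ω => ?_)
        rw [norm_mul]
        exact mul_le_mul (hC ω) (hRle ω) (norm_nonneg _) hC0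
    _ = C * (ε * ∫ ω, s ω ∂μ
        + 4 * ∫ ω, {ω | ε < |y ω|}.indicator (fun ω => y ω ^ 2) ω ∂μ + ∫ ω, s ω ^ 2 ∂μ) := by
        rw [integral_const_mul, integral_add hyi2 hs2,
          integral_add (hy2.const_mul ε) (hind.const_mul 4), integral_const_mul,
          integral_const_mul, hys]
    _ ≤ _ := by
        refine mul_le_mul_of_nonneg_left ?_ hC0
        linarith

/-- For a square-integrable martingale difference sequence whose conditional variances have a
bounded sum, `exp (i S + U / 2)` has expectation close to `1`. -/
theorem norm_integral_cexp_sum_sub_one_le (F : Filtration ℕ m) {y s : ℕ → Ω → ℝ} {n : ℕ}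
    (hym : ∀ k < n, StronglyMeasurable[F (k + 1)] (y k)) (hy : ∀ k < n, MemLp (y k) 2 μ)
    (hy0 : ∀ k < n, μ[y k | F k] =ᵐ[μ] 0) (hs : ∀ k < n, StronglyMeasurable[F k] (s k))
    (hsy : ∀ k < n, s k =ᵐ[μ] μ[fun ω => y k ω ^ 2 | F k]) (hs0 : ∀ k < n, ∀ ω, 0 ≤ s k ω)
    {K : ℝ} (hK : ∀ ω, ∑ k ∈ Finset.range n, s k ω ≤ K) {ε : ℝ} (hε : 0 < ε) (hε1 : ε ≤ 1) :
    ‖∫ ω, Complex.exp (Complex.I * (∑ k ∈ Finset.range n, y k ω : ℝ)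
        + ((∑ k ∈ Finset.range n, s k ω) / 2 : ℝ)) ∂μ - 1‖
      ≤ Real.exp (K / 2) * ((ε + ε ^ 2) * K + (4 + K) * ∑ k ∈ Finset.range n,
        ∫ ω, {ω | ε < |y k ω|}.indicator (fun ω => y k ω ^ 2) ω ∂μ) := by
  have hpart : ∀ j ≤ n, ∀ ω, ∑ k ∈ Finset.range j, s k ω ≤ K := fun j hj ω =>
    (Finset.sum_le_sum_of_subset_of_nonneg (Finset.range_mono hj)
      fun k hk _ => hs0 k (Finset.mem_range.1 hk) ω).trans (hK ω)
  have hsK : ∀ k < n, ∀ ω, s k ω ≤ K := fun k hk ω =>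
    (Finset.single_le_sum (f := fun k => s k ω) (fun k hk => hs0 k (Finset.mem_range.1 hk) ω)
      (Finset.mem_range.2 hk)).trans (hK ω)
  have hsi : ∀ k < n, Integrable (s k) μ := fun k hk =>
    .of_bound ((hs k hk).mono (F.le k)).aestronglyMeasurable K
    (ae_of_all _ fun ω => by rw [Real.norm_of_nonneg (hs0 k hk ω)]; exact hsK k hk ω)
  have hSm : ∀ j ≤ n, StronglyMeasurable[F j] fun ω => ∑ k ∈ Finset.range j, y k ω := by
    intro j hj
    refine Finset.stronglyMeasurable_fun_sum _ fun k hk => ?_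
    have hk := Finset.mem_range.1 hk
    exact (hym k (by omega)).mono (F.mono (by omega))
  -- Predictability: the variance sum may run one index ahead of the time `j`.
  have hUm : ∀ j ≤ n, ∀ i ≤ n, i ≤ j + 1 →
      StronglyMeasurable[F j] fun ω => ∑ k ∈ Finset.range i, s k ω := by
    intro j hj i hin hi
    refine Finset.stronglyMeasurable_fun_sum _ fun k hk => ?_
    have hk := Finset.mem_range.1 hk
    exact (hs k (by omega)).mono (F.mono (by omega))
  have hWm : ∀ j ≤ n, ∀ i ≤ n, i ≤ j + 1 → StronglyMeasurable[F j] fun ω =>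
      Complex.exp (Complex.I * (∑ k ∈ Finset.range j, y k ω : ℝ)
        + ((∑ k ∈ Finset.range i, s k ω) / 2 : ℝ)) := by
    intro j hj i hin hi
    have hc : Continuous fun p : ℝ × ℝ => Complex.exp (Complex.I * (p.1 : ℝ) + (p.2 / 2 : ℝ)) := by
      fun_prop
    exact hc.comp_stronglyMeasurable ((hSm j hj).prodMk (hUm j hj i hin hi))
  have hWn : ∀ j, ∀ i ≤ n, ∀ ω, ‖Complex.exp (Complex.I * (∑ k ∈ Finset.range j, y k ω : ℝ)
        + ((∑ k ∈ Finset.range i, s k ω) / 2 : ℝ))‖ ≤ Real.exp (K / 2) := by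
    intro j i hi ω
    rw [Complex.exp_add, norm_mul, Complex.norm_exp_I_mul_ofReal, Complex.norm_exp_ofReal, one_mul]
    exact Real.exp_le_exp.2 (by linarith [hpart i hi ω])
  have hmain : ∀ j ≤ n, ‖∫ ω, Complex.exp (Complex.I * (∑ k ∈ Finset.range j, y k ω : ℝ)
        + ((∑ k ∈ Finset.range j, s k ω) / 2 : ℝ)) ∂μ - 1‖
      ≤ ∑ k ∈ Finset.range j, Real.exp (K / 2) * ((ε + ε ^ 2) * ∫ ω, s k ω ∂μ
        + (4 + K) * ∫ ω, {ω | ε < |y k ω|}.indicator (fun ω => y k ω ^ 2) ω ∂μ) := by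
    intro j
    induction j with
    | zero => simp
    | succ j ih =>
      intro hj
      have hi (a b : ℕ) (ha : a ≤ n) (hb : b ≤ n) (hab : b ≤ a + 1) :
          Integrable (fun ω => Complex.exp (Complex.I * (∑ k ∈ Finset.range a, y k ω : ℝ)
            + ((∑ k ∈ Finset.range b, s k ω) / 2 : ℝ))) μ :=
        .of_bound ((hWm a ha b hb hab).mono (F.le a)).aestronglyMeasurable _
          (ae_of_all _ (hWn a b hb))
      have hstep := norm_integral_mul_cexp_sub_exp_le (F.le j)
        (hWm j (by omega) (j + 1) hj le_rfl) (hWn j (j + 1) hj) (hy j hj) (hy0 j hj) (hs j hj)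
        (hsy j hj) (hs0 j hj) (hsK j hj) hε hε1
      -- The weight carries S up to `j` but U already up to `j + 1`: the factor exp(iy) completes it
      -- to the next term, while exp(-s/2) takes it back to the current one, so the differences
      -- telescope.
      have e : ∀ ω, Complex.exp (Complex.I * (∑ k ∈ Finset.range j, y k ω : ℝ)
          + ((∑ k ∈ Finset.range (j + 1), s k ω) / 2 : ℝ))
          * (Complex.exp (Complex.I * y j ω) - Complex.exp (-(s j ω / 2 : ℝ)))
          = Complex.exp (Complex.I * (∑ k ∈ Finset.range (j + 1), y k ω : ℝ)
            + ((∑ k ∈ Finset.range (j + 1), s k ω) / 2 : ℝ))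
          - Complex.exp (Complex.I * (∑ k ∈ Finset.range j, y k ω : ℝ)
            + ((∑ k ∈ Finset.range j, s k ω) / 2 : ℝ)) := by
        intro ω
        rw [mul_sub, ← Complex.exp_add, ← Complex.exp_add]
        congr 2
        · rw [Finset.sum_range_succ (fun k => y k ω)]; push_cast; ring
        · rw [Finset.sum_range_succ]; push_cast; ring
      simp_rw [e] at hstep
      rw [integral_sub (hi _ _ hj hj (by omega)) (hi _ _ (by omega) (by omega) (by omega))] at hstep
      rw [Finset.sum_range_succ]
      refine le_trans ?_ (add_le_add (ih (by omega)) hstep)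
      refine le_trans (le_of_eq ?_) (norm_add_le _ _)
      congr 1; ring
  refine (hmain n le_rfl).trans ?_
  rw [← Finset.mul_sum, Finset.sum_add_distrib, ← Finset.mul_sum, ← Finset.mul_sum,
    ← integral_finsetSum _ fun k hk => hsi k (Finset.mem_range.1 hk)]
  have : ∫ ω, ∑ k ∈ Finset.range n, s k ω ∂μ ≤ K := by
    refine (integral_mono (integrable_finsetSum _ fun k hk => hsi k (Finset.mem_range.1 hk))
      (integrable_const K) hK).trans (by simp)
  gcongr

/-- Bounded convergence for convergence in probability to zero. -/
theorem tendsto_integral_of_tendstoInMeasure_zero {f : ℕ → Ω → ℝ} {K : ℝ}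
    (hf : ∀ n, AEStronglyMeasurable (f n) μ) (hK : ∀ n, ∀ᵐ ω ∂μ, ‖f n ω‖ ≤ K)
    (h : TendstoInMeasure μ f atTop fun _ => (0 : ℝ)) :
    Tendsto (fun n => ∫ ω, f n ω ∂μ) atTop (nhds 0) := by
  refine tendsto_of_subseq_tendsto fun ns hns => ?_
  obtain ⟨ms, -, hms⟩ := (h.comp hns).exists_seq_tendsto_ae
  refine ⟨ms, ?_⟩
  have := tendsto_integral_of_dominated_convergence (μ := μ) (fun _ => K)
    (fun n => hf (ns (ms n))) (integrable_const K) (fun n => hK (ns (ms n))) hms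
  simpa using this

end Integrals

/-! ### Stopping, and the scalar limit theorem. -/

section Scalar

variable {Ω : Type*} {m : MeasurableSpace Ω} {μ : Measure Ω}

/-- Stopping a sum of nonnegative terms at the last index where its partial sums are at most `K`
gives a sum that is at most `K`. -/
theorem sum_ite_partial_sum_le (q : ℕ → ℝ) (hq : ∀ k, 0 ≤ q k) {K : ℝ} (hK : 0 ≤ K) (n : ℕ) :
    ∑ k ∈ Finset.range n, (if ∑ i ∈ Finset.range (k + 1), q i ≤ K then q k else 0) ≤ K := by
  induction n with
  | zero => simpa
  | succ n ih =>
    by_cases h : ∑ i ∈ Finset.range (n + 1), q i ≤ K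
    · refine le_trans (Finset.sum_le_sum fun k _ => ?_) h
      split_ifs
      · exact le_rfl
      · exact hq k
    · rw [Finset.sum_range_succ, if_neg h, add_zero]
      exact ih

theorem tendstoInMeasure_min_abs_sub {f : ℕ → Ω → ℝ} {c K : ℝ} (hK : 0 ≤ K)
    (h : TendstoInMeasure μ f atTop fun _ => c) :
    TendstoInMeasure μ (fun n ω => min |f n ω - c| K) atTop fun _ => (0 : ℝ) := by
  rw [tendstoInMeasure_iff_norm] at h ⊢
  intro ε hε
  refine tendsto_of_tendsto_of_tendsto_of_le_of_le tendsto_const_nhds (h ε hε)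
    (fun _ => zero_le) fun n => measure_mono fun ω hω => ?_
  simp only [Set.mem_ofPred_eq, sub_zero, Real.norm_eq_abs] at hω ⊢
  rw [abs_of_nonneg (le_min (abs_nonneg _) hK)] at hω
  exact hω.trans (min_le_left _ _)

variable [IsProbabilityMeasure μ]

/-- Quantitative form of the scalar martingale central limit theorem for one row. -/
theorem norm_integral_cexp_sum_sub_exp_le (F : Filtration ℕ m) {x : ℕ → Ω → ℝ} {n : ℕ}
    (hxm : ∀ k < n, StronglyMeasurable[F (k + 1)] (x k)) (hx : ∀ k < n, MemLp (x k) 2 μ)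
    (hx0 : ∀ k < n, μ[x k | F k] =ᵐ[μ] 0) {v : ℝ} (hv : 0 ≤ v) {ε : ℝ} (hε : 0 < ε)
    (hε1 : ε ≤ 1) :
    ‖∫ ω, Complex.exp (Complex.I * (∑ k ∈ Finset.range n, x k ω : ℝ)) ∂μ
        - (Real.exp (-(v / 2)) : ℝ)‖
      ≤ 3 * ∫ ω, min |∑ k ∈ Finset.range n, (μ[fun ω => x k ω ^ 2 | F k]) ω - v| 1 ∂μ
        + Real.exp ((v + 1) / 2) * ((ε + ε ^ 2) * (v + 1) + (4 + (v + 1)) *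
          ∫ ω, min |∑ k ∈ Finset.range n,
            (μ[{ω | ε < |x k ω|}.indicator (fun ω => x k ω ^ 2) | F k]) ω| (v + 1) ∂μ) := by
  -- The margin 1 matters: if stopping occurs, the variance sum exceeds v by more than 1, so its
  -- capped deviation from v equals 1.
  set K := v + 1 with hKdef
  have hK0 : 0 ≤ K := by linarith
  -- A version of the conditional variance that is nonnegative everywhere, so that the bounds on
  -- stopped sums hold for every ω.
  set q : ℕ → Ω → ℝ := fun k ω => max ((μ[fun ω => x k ω ^ 2 | F k]) ω) 0 with hq
  have hqm : ∀ k, StronglyMeasurable[F k] (q k) := fun k =>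
    (continuous_id.max continuous_const).comp_stronglyMeasurable stronglyMeasurable_condExp
  have hq0 : ∀ k ω, 0 ≤ q k ω := fun k ω => le_max_right _ _
  have hqae : ∀ k < n, q k =ᵐ[μ] μ[fun ω => x k ω ^ 2 | F k] := by
    intro k hk
    filter_upwards [condExp_nonneg (m := F k) (ae_of_all μ fun ω => sq_nonneg (x k ω))] with ω h
    exact max_eq_left h
  -- The sum includes index `k` itself, yet the event lies in `F k`, so its indicator passes through
  -- the conditional expectations given `F k`.
  set A : ℕ → Set Ω := fun k => {ω | ∑ i ∈ Finset.range (k + 1), q i ω ≤ K} with hA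
  have hAm : ∀ k, MeasurableSet[F k] (A k) := by
    intro k
    have h : StronglyMeasurable[F k] fun ω => ∑ i ∈ Finset.range (k + 1), q i ω :=
      Finset.stronglyMeasurable_fun_sum _ fun i hi =>
        (hqm i).mono (F.mono (by have := Finset.mem_range.1 hi; omega))
    exact h.measurable measurableSet_Iic
  set y : ℕ → Ω → ℝ := fun k => (A k).indicator (x k) with hy
  set s : ℕ → Ω → ℝ := fun k => (A k).indicator (q k) with hs
  have hs0 : ∀ k ω, 0 ≤ s k ω := fun k ω => Set.indicator_nonneg (fun ω _ => hq0 k ω) ω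
  have hsK : ∀ ω, ∑ k ∈ Finset.range n, s k ω ≤ K := fun ω => by
    convert sum_ite_partial_sum_le (fun k => q k ω) (fun k => hq0 k ω) hK0 n with k
    simp only [hs, hA, Set.indicator, Set.mem_ofPred_eq]
  have hysq : ∀ k, (fun ω => y k ω ^ 2) = (A k).indicator fun ω => x k ω ^ 2 := by
    intro k; ext ω
    by_cases h : ω ∈ A k <;> simp [hy, h]
  have hyind : ∀ k, {ω | ε < |y k ω|}.indicator (fun ω => y k ω ^ 2)
      = (A k).indicator ({ω | ε < |x k ω|}.indicator fun ω => x k ω ^ 2) := by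
    intro k; ext ω
    by_cases h : ω ∈ A k <;> simp [hy, h, Set.indicator]
  have hym : ∀ k < n, StronglyMeasurable[F (k + 1)] (y k) := fun k hk =>
    (hxm k hk).indicator (F.mono (Nat.le_succ k) _ (hAm k))
  have hyL : ∀ k < n, MemLp (y k) 2 μ := fun k hk => (hx k hk).indicator (F.le k _ (hAm k))
  have hy0 : ∀ k < n, μ[y k | F k] =ᵐ[μ] 0 := by
    intro k hk
    filter_upwards [condExp_indicator (m := F k) ((hx k hk).integrable (by norm_num)) (hAm k),
      hx0 k hk] with ω h1 h2
    rw [h1]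
    by_cases h : ω ∈ A k <;> simp [h, h2]
  have hsy : ∀ k < n, s k =ᵐ[μ] μ[fun ω => y k ω ^ 2 | F k] := by
    intro k hk
    rw [hysq]
    filter_upwards [condExp_indicator (m := F k) (hx k hk).integrable_sq (hAm k),
      hqae k hk] with ω h1 h2
    rw [h1]
    by_cases h : ω ∈ A k <;> simp [hs, h, h2]
  have hrow := norm_integral_cexp_sum_sub_one_le (μ := μ) F hym hyL hy0
    (fun k _ => (hqm k).indicator (hAm k)) hsy (fun k _ => hs0 k) hsK hε hε1
  set l : ℕ → Ω → ℝ := fun k => μ[{ω | ε < |x k ω|}.indicator (fun ω => x k ω ^ 2) | F k] with hl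
  have hl0 : ∀ k, 0 ≤ᵐ[μ] l k := fun k =>
    condExp_nonneg (ae_of_all μ fun ω => Set.indicator_nonneg (fun ω _ => sq_nonneg _) ω)
  have hlq : ∀ k < n, ∀ᵐ ω ∂μ, l k ω ≤ q k ω := by
    intro k hk
    filter_upwards [condExp_mono (m := F k) (integrable_indicator_sq (hx k hk) ε)
      (hx k hk).integrable_sq (ae_of_all μ fun ω =>
        Set.indicator_le_self' (fun ω _ => sq_nonneg (x k ω)) ω)] with ω h
    exact h.trans (le_max_left _ _)
  have hLm : AEStronglyMeasurable (fun ω => ∑ k ∈ Finset.range n, l k ω) μ :=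
    (Finset.stronglyMeasurable_fun_sum _ fun k _ =>
      stronglyMeasurable_condExp.mono (F.le k)).aestronglyMeasurable
  -- The stopped Lindeberg sum is at most the full one, and also at most `K` because each term is
  -- dominated by the conditional variance; this gives the cap.
  have hLind : ∑ k ∈ Finset.range n, ∫ ω, {ω | ε < |y k ω|}.indicator (fun ω => y k ω ^ 2) ω ∂μ
      ≤ ∫ ω, min |∑ k ∈ Finset.range n, l k ω| K ∂μ := by
    have h1 : ∀ k ∈ Finset.range n, ∫ ω, {ω | ε < |y k ω|}.indicator (fun ω => y k ω ^ 2) ω ∂μ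
        = ∫ ω, (A k).indicator (l k) ω ∂μ := by
      intro k hk
      rw [hyind, ← integral_condExp (F.le k)]
      exact integral_congr_ae (condExp_indicator
        (integrable_indicator_sq (hx k (Finset.mem_range.1 hk)) ε) (hAm k))
    have hi : ∀ k ∈ Finset.range n, Integrable ((A k).indicator (l k)) μ := fun k _ =>
      integrable_condExp.indicator (F.le k _ (hAm k))
    rw [Finset.sum_congr rfl h1, ← integral_finsetSum _ hi]
    refine integral_mono_ae (integrable_finsetSum _ hi) ?_ ?_
    · refine .of_bound (hLm.norm.inf aestronglyMeasurable_const) K (ae_of_all _ fun ω => ?_)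
      rw [Real.norm_of_nonneg (le_min (abs_nonneg _) hK0)]
      exact min_le_right _ _
    · have h2 : ∀ᵐ ω ∂μ, ∀ k ∈ Finset.range n, 0 ≤ l k ω ∧ l k ω ≤ q k ω := by
        rw [Finset.eventually_all]
        intro k hk
        filter_upwards [hl0 k, hlq k (Finset.mem_range.1 hk)] with ω a b using ⟨a, b⟩
      filter_upwards [h2] with ω h2
      refine le_min (le_trans (Finset.sum_le_sum fun k hk => ?_) (le_abs_self _))
        (le_trans (Finset.sum_le_sum fun k hk => ?_) (hsK ω))
      · exact Set.indicator_apply_le' (fun _ => le_rfl) (fun _ => (h2 k hk).1)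
      · exact Set.indicator_le_indicator (h2 k hk).2
  have hVm : AEStronglyMeasurable
      (fun ω => ∑ k ∈ Finset.range n, (μ[fun ω => x k ω ^ 2 | F k]) ω) μ :=
    (Finset.stronglyMeasurable_fun_sum _ fun k _ =>
      stronglyMeasurable_condExp.mono (F.le k)).aestronglyMeasurable
  have hSxm : AEMeasurable (fun ω => ∑ k ∈ Finset.range n, x k ω) μ :=
    Finset.aemeasurable_fun_sum _ fun k hk =>
      ((hxm k (Finset.mem_range.1 hk)).mono (F.le _)).measurable.aemeasurable
  have hSym : AEMeasurable (fun ω => ∑ k ∈ Finset.range n, y k ω) μ :=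
    Finset.aemeasurable_fun_sum _ fun k hk =>
      ((hym k (Finset.mem_range.1 hk)).mono (F.le _)).measurable.aemeasurable
  have hUm : AEMeasurable (fun ω => ∑ k ∈ Finset.range n, s k ω) μ :=
    Finset.aemeasurable_fun_sum _ fun k hk =>
      (((hqm k).indicator (hAm k)).mono (F.le _)).measurable.aemeasurable
  set X : Ω → ℂ := fun ω => Complex.exp (Complex.I * (∑ k ∈ Finset.range n, x k ω : ℝ)) with hX
  set Z : Ω → ℂ := fun ω => Complex.exp (Complex.I * (∑ k ∈ Finset.range n, y k ω : ℝ)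
        + ((∑ k ∈ Finset.range n, s k ω) / 2 : ℝ)) with hZ
  have hXi : Integrable X μ := by
    refine .of_bound (C := 1) ?_ (ae_of_all _ fun ω => ?_)
    · exact AEMeasurable.aestronglyMeasurable (by fun_prop)
    · rw [Complex.norm_exp_I_mul_ofReal]
  have hZn : ∀ ω, ‖Z ω‖ = Real.exp ((∑ k ∈ Finset.range n, s k ω) / 2) := fun ω => by
    simp only [hZ]
    rw [Complex.exp_add, norm_mul, Complex.norm_exp_I_mul_ofReal, Complex.norm_exp_ofReal, one_mul]
  have hZi : Integrable Z μ := by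
    refine .of_bound (C := Real.exp (K / 2)) ?_ (ae_of_all _ fun ω => ?_)
    · exact AEMeasurable.aestronglyMeasurable (by fun_prop)
    · rw [hZn]
      exact Real.exp_le_exp.2 (by linarith [hsK ω])
  -- Without stopping, the two exponentials differ by the factor e^u, and |1 - e^u| ≤ 2|u|. With
  -- stopping, the cap is reached and the crude bound 1 + e^u ≤ 3 suffices.
  have hdiff : ∀ᵐ ω ∂μ, ‖X ω - (Real.exp (-(v / 2)) : ℝ) * Z ω‖
      ≤ 3 * min |∑ k ∈ Finset.range n, (μ[fun ω => x k ω ^ 2 | F k]) ω - v| 1 := by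
    have h1 : ∀ᵐ ω ∂μ, ∀ k ∈ Finset.range n, q k ω = (μ[fun ω => x k ω ^ 2 | F k]) ω := by
      rw [Finset.eventually_all]
      exact fun k hk => hqae k (Finset.mem_range.1 hk)
    filter_upwards [h1] with ω h1
    rw [← Finset.sum_congr rfl h1]
    set u := (∑ k ∈ Finset.range n, s k ω - v) / 2 with hu
    have hu1 : u ≤ 1 / 2 := by linarith [hsK ω]
    have hexp : Real.exp u ≤ 2 := by
      have := Real.exp_one_lt_d9
      have h2 : Real.exp u ≤ Real.exp (1 / 2) := Real.exp_le_exp.2 hu1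
      have h3 : Real.exp (1 / 2) * Real.exp (1 / 2) = Real.exp 1 := by
        rw [← Real.exp_add]; norm_num
      nlinarith [Real.exp_pos (1 / 2)]
    have hvZ : (Real.exp (-(v / 2)) : ℝ) * Z ω
        = Complex.exp (Complex.I * (∑ k ∈ Finset.range n, y k ω : ℝ)) * (Real.exp u : ℝ) := by
      simp only [hZ, hu]
      push_cast
      rw [← Complex.exp_add, ← Complex.exp_add]
      congr 1; ring
    rw [hvZ]
    have hbound : ‖X ω - Complex.exp (Complex.I * (∑ k ∈ Finset.range n, y k ω : ℝ))
        * (Real.exp u : ℝ)‖ ≤ 3 := by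
      refine (norm_sub_le _ _).trans ?_
      rw [norm_mul, Complex.norm_exp_I_mul_ofReal, Complex.norm_exp_I_mul_ofReal,
        Complex.norm_real, Real.norm_of_nonneg (Real.exp_pos u).le]
      linarith
    by_cases hT : ∑ k ∈ Finset.range n, q k ω ≤ K
    · have hmem : ∀ k ∈ Finset.range n, ω ∈ A k := fun k hk =>
        (Finset.sum_le_sum_of_subset_of_nonneg
          (Finset.range_mono (Finset.mem_range.1 hk)) fun i _ _ => hq0 i ω).trans hT
      have hxy : ∑ k ∈ Finset.range n, y k ω = ∑ k ∈ Finset.range n, x k ω :=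
        Finset.sum_congr rfl fun k hk => Set.indicator_of_mem (hmem k hk) _
      have hsq : ∑ k ∈ Finset.range n, s k ω = ∑ k ∈ Finset.range n, q k ω :=
        Finset.sum_congr rfl fun k hk => Set.indicator_of_mem (hmem k hk) _
      have h5 : ‖X ω - Complex.exp (Complex.I * (∑ k ∈ Finset.range n, y k ω : ℝ))
          * (Real.exp u : ℝ)‖ = |1 - Real.exp u| := by
        rw [hxy]
        have : X ω - Complex.exp (Complex.I * (∑ k ∈ Finset.range n, x k ω : ℝ))
          * (Real.exp u : ℝ) = X ω * ((1 - Real.exp u : ℝ) : ℂ) := by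
          simp only [hX]; push_cast; ring
        rw [this, norm_mul, Complex.norm_exp_I_mul_ofReal, Complex.norm_real, one_mul,
          Real.norm_eq_abs]
      have h6 : |1 - Real.exp u| ≤ |∑ k ∈ Finset.range n, q k ω - v| := by
        refine (abs_one_sub_exp_le_two_mul hu1).trans ?_
        rw [hu, hsq, abs_div, abs_two]
        linarith
      rcases min_choice |∑ k ∈ Finset.range n, q k ω - v| 1 with h | h
      · rw [h, h5]
        linarith [abs_nonneg (∑ k ∈ Finset.range n, q k ω - v)]
      · rw [h, mul_one]; exact hbound
    · rw [min_eq_right, mul_one]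
      · exact hbound
      · exact le_trans (by linarith) (le_abs_self _)
  have hsplit : ∫ ω, X ω ∂μ - (Real.exp (-(v / 2)) : ℝ)
      = ∫ ω, (X ω - (Real.exp (-(v / 2)) : ℝ) * Z ω) ∂μ
        + (Real.exp (-(v / 2)) : ℝ) * (∫ ω, Z ω ∂μ - 1) := by
    rw [integral_sub hXi (hZi.const_mul _), integral_const_mul]
    ring
  have hmi : Integrable (fun ω =>
      min |∑ k ∈ Finset.range n, (μ[fun ω => x k ω ^ 2 | F k]) ω - v| 1) μ := by
    refine .of_bound ((hVm.sub aestronglyMeasurable_const).norm.inf aestronglyMeasurable_const) 1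
      (ae_of_all _ fun ω => ?_)
    rw [Real.norm_of_nonneg (le_min (abs_nonneg _) zero_le_one)]
    exact min_le_right _ _
  rw [hsplit]
  refine (norm_add_le _ _).trans (add_le_add ?_ ?_)
  · rw [← integral_const_mul]
    exact norm_integral_le_of_norm_le (hmi.const_mul 3) hdiff
  · rw [norm_mul, Complex.norm_real, Real.norm_of_nonneg (Real.exp_pos _).le]
    have h1 : Real.exp (-(v / 2)) ≤ 1 := Real.exp_le_one_iff.2 (by linarith)
    refine (mul_le_of_le_one_left (norm_nonneg _) h1).trans (hrow.trans ?_)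
    gcongr

/-- Convergence in probability alone does not control expectations; the cap makes bounded
convergence available. -/
theorem tendsto_integral_min_abs_sub {f : ℕ → Ω → ℝ} {c K : ℝ} (hK : 0 ≤ K)
    (hf : ∀ n, AEStronglyMeasurable (f n) μ) (h : TendstoInMeasure μ f atTop fun _ => c) :
    Tendsto (fun n => ∫ ω, min |f n ω - c| K ∂μ) atTop (nhds 0) := by
  refine tendsto_integral_of_tendstoInMeasure_zero (K := K)
    (fun n => ((hf n).sub aestronglyMeasurable_const).norm.inf aestronglyMeasurable_const)
    (fun n => ae_of_all _ fun ω => ?_) (tendstoInMeasure_min_abs_sub hK h)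
  rw [Real.norm_of_nonneg (le_min (abs_nonneg _) hK)]
  exact min_le_right _ _

/-- Scalar martingale central limit theorem, at the level of characteristic functions. -/
theorem tendsto_integral_cexp_sum_of_conditionalLindeberg (F : ℕ → Filtration ℕ m)
    {x : ℕ → ℕ → Ω → ℝ} (hxm : ∀ n, ∀ k < n, StronglyMeasurable[F n (k + 1)] (x n k))
    (hx : ∀ n, ∀ k < n, MemLp (x n k) 2 μ) (hx0 : ∀ n, ∀ k < n, μ[x n k | F n k] =ᵐ[μ] 0)
    {v : ℝ} (hv : 0 ≤ v)
    (hV : TendstoInMeasure μ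
      (fun n ω => ∑ k ∈ Finset.range n, (μ[fun ω => x n k ω ^ 2 | F n k]) ω) atTop fun _ => v)
    (hL : ∀ ε : ℝ, 0 < ε → TendstoInMeasure μ (fun n ω => ∑ k ∈ Finset.range n,
      (μ[{ω | ε < |x n k ω|}.indicator (fun ω => x n k ω ^ 2) | F n k]) ω) atTop
        fun _ => (0 : ℝ)) :
    Tendsto (fun n => ∫ ω, Complex.exp (Complex.I * (∑ k ∈ Finset.range n, x n k ω : ℝ)) ∂μ)
      atTop (nhds (Real.exp (-(v / 2)) : ℝ)) := by
  rw [tendsto_iff_norm_sub_tendsto_zero]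
  -- First n → ∞ with ε fixed, which leaves a bound vanishing with ε; only then is ε chosen small.
  have hb : ∀ ε : ℝ, 0 < ε → Tendsto (fun n =>
      3 * ∫ ω, min |∑ k ∈ Finset.range n, (μ[fun ω => x n k ω ^ 2 | F n k]) ω - v| 1 ∂μ
        + Real.exp ((v + 1) / 2) * ((ε + ε ^ 2) * (v + 1) + (4 + (v + 1)) *
          ∫ ω, min |∑ k ∈ Finset.range n,
            (μ[{ω | ε < |x n k ω|}.indicator (fun ω => x n k ω ^ 2) | F n k]) ω| (v + 1) ∂μ))
      atTop (nhds (Real.exp ((v + 1) / 2) * ((ε + ε ^ 2) * (v + 1)))) := by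
    intro ε hε
    have hm (f : ℕ → ℕ → Ω → ℝ) (n : ℕ) : AEStronglyMeasurable
        (fun ω => ∑ k ∈ Finset.range n, (μ[f n k | F n k]) ω) μ :=
      (Finset.stronglyMeasurable_fun_sum _ fun k _ =>
        stronglyMeasurable_condExp.mono ((F n).le k)).aestronglyMeasurable
    have h1 := tendsto_integral_min_abs_sub zero_le_one (hm fun n k ω => x n k ω ^ 2) hV
    have h2 := tendsto_integral_min_abs_sub (K := v + 1) (by linarith)
      (hm fun n k => {ω | ε < |x n k ω|}.indicator (fun ω => x n k ω ^ 2)) (hL ε hε)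
    simp only [sub_zero] at h2
    simpa using (h1.const_mul 3).add
      (((h2.const_mul (4 + (v + 1))).const_add ((ε + ε ^ 2) * (v + 1))).const_mul
        (Real.exp ((v + 1) / 2)))
  have hc : Tendsto (fun ε : ℝ => Real.exp ((v + 1) / 2) * ((ε + ε ^ 2) * (v + 1)))
      (nhdsWithin 0 (Set.Ioi 0)) (nhds 0) := by
    have : Continuous fun ε : ℝ => Real.exp ((v + 1) / 2) * ((ε + ε ^ 2) * (v + 1)) := by fun_prop
    simpa using (this.tendsto 0).mono_left nhdsWithin_le_nhds
  rw [Metric.tendsto_atTop]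
  intro δ hδ
  obtain ⟨ε, ⟨h1, h2⟩, h3⟩ := ((hc.eventually_lt_const hδ).and
    (Ioc_mem_nhdsGT (zero_lt_one' ℝ))).exists.imp fun ε h => (⟨⟨h.2.1, h.2.2⟩, h.1⟩ :
      (0 < ε ∧ ε ≤ 1) ∧ Real.exp ((v + 1) / 2) * ((ε + ε ^ 2) * (v + 1)) < δ)
  obtain ⟨N, hN⟩ := eventually_atTop.1 ((hb ε h1).eventually_lt_const h3)
  refine ⟨N, fun n hn => ?_⟩
  rw [dist_zero_right, norm_norm]
  exact (norm_integral_cexp_sum_sub_exp_le (F n) (hxm n) (hx n) (hx0 n) hv h1 h2).trans_lt (hN n hn)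

end Scalar

/-! ### Convergence in probability to constants. -/

section ConvergenceInProbability

variable {Ω : Type*} {m : MeasurableSpace Ω} {μ : Measure Ω}

theorem tendstoInMeasure_of_abs_sub_le_mul {f g : ℕ → Ω → ℝ} {a b C : ℝ} (hC : 0 < C)
    (hfg : ∀ n, ∀ᵐ ω ∂μ, |g n ω - b| ≤ C * |f n ω - a|)
    (h : TendstoInMeasure μ f atTop fun _ => a) : TendstoInMeasure μ g atTop fun _ => b := by
  rw [tendstoInMeasure_iff_norm] at h ⊢
  intro ε hε
  refine tendsto_of_tendsto_of_tendsto_of_le_of_le tendsto_const_nhds (h (ε / C) (by positivity))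
    (fun _ => zero_le) fun n => measure_mono_ae ?_
  filter_upwards [hfg n] with ω hω hε'
  change ε / C ≤ |f n ω - a|
  rw [div_le_iff₀' hC]
  exact le_trans hε' hω

theorem tendstoInMeasure_add_const {f g : ℕ → Ω → ℝ} {a b : ℝ}
    (hf : TendstoInMeasure μ f atTop fun _ => a) (hg : TendstoInMeasure μ g atTop fun _ => b) :
    TendstoInMeasure μ (fun n ω => f n ω + g n ω) atTop fun _ => a + b := by
  rw [tendstoInMeasure_iff_norm] at hf hg ⊢
  intro ε hε
  have hsum := (hf (ε / 2) (by positivity)).add (hg (ε / 2) (by positivity))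
  rw [add_zero] at hsum
  refine tendsto_of_tendsto_of_tendsto_of_le_of_le tendsto_const_nhds hsum
    (fun _ => zero_le) fun n => (measure_mono fun ω hω => ?_).trans (measure_union_le _ _)
  by_contra hcon
  simp only [Set.mem_union, Set.mem_ofPred_eq, not_or, not_le, Real.norm_eq_abs] at hω hcon
  have := abs_add_le (f n ω - a) (g n ω - b)
  rw [show f n ω - a + (g n ω - b) = f n ω + g n ω - (a + b) by ring] at this
  linarith [hcon.1, hcon.2]

theorem tendstoInMeasure_sum_mul {ι : Type*} (I : Finset ι) (w c : ι → ℝ) {f : ι → ℕ → Ω → ℝ}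
    (hf : ∀ i, TendstoInMeasure μ (f i) atTop fun _ => c i) :
    TendstoInMeasure μ (fun n ω => ∑ i ∈ I, w i * f i n ω) atTop fun _ => ∑ i ∈ I, w i * c i := by
  classical
  induction I using Finset.induction_on with
  | empty => exact fun ε hε => by simp [hε.ne']
  | insert i I hi ih =>
    simp only [Finset.sum_insert hi]
    refine tendstoInMeasure_add_const ?_ ih
    refine tendstoInMeasure_of_abs_sub_le_mul (C := |w i| + 1) (by positivity)
      (fun n => ae_of_all _ fun ω => ?_) (hf i)
    rw [← mul_sub, abs_mul]
    nlinarith [abs_nonneg (f i n ω - c i)]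

theorem const_nonneg_of_tendstoInMeasure [IsProbabilityMeasure μ] {f : ℕ → Ω → ℝ} {a : ℝ}
    (hf : ∀ n, 0 ≤ᵐ[μ] f n) (h : TendstoInMeasure μ f atTop fun _ => a) : 0 ≤ a := by
  obtain ⟨ns, -, hns⟩ := h.exists_seq_tendsto_ae
  obtain ⟨ω, h1, h2⟩ := (hns.and (ae_all_iff.2 hf)).exists
  exact ge_of_tendsto' h1 fun i => h2 (ns i)

end ConvergenceInProbability

/-! ### Linear marginals of random vectors. -/

section Vector

variable {Ω : Type*} {m : MeasurableSpace Ω} {μ : Measure Ω} {d : ℕ}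

open scoped Matrix

theorem dotProduct_mulVec_eq_sum (t : EuclideanSpace ℝ (Fin d)) (M : Matrix (Fin d) (Fin d) ℝ) :
    t.ofLp ⬝ᵥ M *ᵥ t.ofLp = ∑ p : Fin d × Fin d, t p.1 * t p.2 * M p.1 p.2 := by
  rw [Fintype.sum_prod_type]
  simp only [dotProduct, Matrix.mulVec, Finset.mul_sum]
  exact Finset.sum_congr rfl fun i _ => Finset.sum_congr rfl fun j _ => by ring

/-- The squared marginal is a fixed linear combination of the products of coordinates, which are
integrable because `Y` is square-integrable, so linearity of conditional expectation applies. -/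
theorem condExp_inner_sq {m' : MeasurableSpace Ω} {Y : Ω → EuclideanSpace ℝ (Fin d)}
    (hY : MemLp Y 2 μ) (t : EuclideanSpace ℝ (Fin d)) :
    μ[fun ω => inner ℝ (Y ω) t ^ 2 | m']
      =ᵐ[μ] fun ω => t.ofLp ⬝ᵥ condSecondMoment μ m' Y ω *ᵥ t.ofLp := by
  have hYi : ∀ i, MemLp (fun ω => Y ω i) 2 μ := fun i =>
    (EuclideanSpace.proj (𝕜 := ℝ) i).comp_memLp' hY
  have hint : ∀ p : Fin d × Fin d,
      Integrable (fun ω => Matrix.vecMulVec (Y ω).ofLp (Y ω).ofLp p.1 p.2) μ := fun p =>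
    (hYi p.1).integrable_mul (hYi p.2)
  have e : (fun ω => inner ℝ (Y ω) t ^ 2) = ∑ p : Fin d × Fin d,
      (t p.1 * t p.2) • fun ω => Matrix.vecMulVec (Y ω).ofLp (Y ω).ofLp p.1 p.2 := by
    ext ω
    simp only [Finset.sum_apply, Pi.smul_apply, smul_eq_mul]
    rw [Fintype.sum_prod_type, sq, PiLp.inner_apply, Finset.sum_mul_sum]
    refine Finset.sum_congr rfl fun i _ => Finset.sum_congr rfl fun j _ => ?_
    simp only [Matrix.vecMulVec_apply, RCLike.inner_apply, conj_trivial]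
    ring
  rw [e]
  have h1 := condExp_finsetSum (μ := μ) (s := Finset.univ)
    (fun (p : Fin d × Fin d) _ => (hint p).smul (t p.1 * t p.2)) m'
  have h2 : ∀ᵐ ω ∂μ, ∀ p : Fin d × Fin d,
      (μ[(t p.1 * t p.2) • fun ω => Matrix.vecMulVec (Y ω).ofLp (Y ω).ofLp p.1 p.2 | m']) ω
        = (t p.1 * t p.2) * condSecondMoment μ m' Y ω p.1 p.2 := by
    rw [ae_all_iff]
    intro p
    filter_upwards [condExp_smul (μ := μ) (t p.1 * t p.2)
      (fun ω => Matrix.vecMulVec (Y ω).ofLp (Y ω).ofLp p.1 p.2) m'] with ω h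
    rw [h]
    rfl
  filter_upwards [h1, h2] with ω h1 h2
  rw [h1, Finset.sum_apply, dotProduct_mulVec_eq_sum]
  exact Finset.sum_congr rfl fun p _ => h2 p

theorem condExp_inner_eq_zero {m' : MeasurableSpace Ω} {Y : Ω → EuclideanSpace ℝ (Fin d)}
    (hY : Integrable Y μ) (h0 : μ[Y | m'] =ᵐ[μ] 0) (t : EuclideanSpace ℝ (Fin d)) :
    μ[fun ω => inner ℝ (Y ω) t | m'] =ᵐ[μ] 0 := by
  have h := (innerSL ℝ t).comp_condExp_comm (m := m') hY
  have e : (innerSL ℝ t ∘ Y) = fun ω => inner ℝ (Y ω) t := by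
    ext ω; simp [real_inner_comm]
  rw [e] at h
  filter_upwards [h, h0] with ω h1 h2
  rw [← h1]
  simp [h2]

/-- The tail part of a linear marginal is dominated by that of the vector. -/
theorem indicator_inner_sq_le (Y t : EuclideanSpace ℝ (Fin d)) {ε : ℝ} :
    {z : ℝ | ε < |z|}.indicator (fun z => z ^ 2) (inner ℝ Y t) ≤ (‖t‖ + 1) ^ 2
      * {y : EuclideanSpace ℝ (Fin d) | ε / (‖t‖ + 1) < ‖y‖}.indicator (fun y => ‖y‖ ^ 2) Y := by
  -- The factor ‖t‖ + 1 instead of ‖t‖ keeps the threshold ε/(‖t‖ + 1) meaningful at t = 0.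
  have h1 : |inner ℝ Y t| ≤ (‖t‖ + 1) * ‖Y‖ :=
    (abs_real_inner_le_norm Y t).trans (by nlinarith [norm_nonneg Y])
  have ht : 0 < ‖t‖ + 1 := by positivity
  by_cases h : ε < |inner ℝ Y t|
  · have h2 : ε / (‖t‖ + 1) < ‖Y‖ := by
      rw [div_lt_iff₀' ht]; exact h.trans_le h1
    rw [Set.indicator_of_mem (by simpa using h), Set.indicator_of_mem (by simpa using h2),
      ← mul_pow, ← sq_abs]
    exact pow_le_pow_left₀ (abs_nonneg _) h1 2
  · rw [Set.indicator_of_notMem (by simpa using h)]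
    exact mul_nonneg (sq_nonneg _) (Set.indicator_nonneg (fun y _ => sq_nonneg ‖y‖) Y)

theorem condExp_indicator_inner_sq_le {m' : MeasurableSpace Ω}
    {Y : Ω → EuclideanSpace ℝ (Fin d)} (hY : MemLp Y 2 μ) (t : EuclideanSpace ℝ (Fin d)) (ε : ℝ) :
    ∀ᵐ ω ∂μ, (μ[{ω | ε < |inner ℝ (Y ω) t|}.indicator (fun ω => inner ℝ (Y ω) t ^ 2) | m']) ω
      ≤ (‖t‖ + 1) ^ 2
        * (μ[{ω | ε / (‖t‖ + 1) < ‖Y ω‖}.indicator (fun ω => ‖Y ω‖ ^ 2) | m']) ω := by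
  have hYt : MemLp (fun ω => inner ℝ (Y ω) t) 2 μ := hY.inner_const t
  have hi : Integrable ({ω | ε / (‖t‖ + 1) < ‖Y ω‖}.indicator (fun ω => ‖Y ω‖ ^ 2)) μ := by
    simpa using integrable_indicator_sq hY.norm (ε / (‖t‖ + 1))
  have h1 := condExp_mono (m := m') (integrable_indicator_sq hYt ε) (hi.smul ((‖t‖ + 1) ^ 2))
    (ae_of_all _ fun ω => indicator_inner_sq_le (Y ω) t)
  filter_upwards [h1, condExp_smul (μ := μ) ((‖t‖ + 1) ^ 2)
    ({ω | ε / (‖t‖ + 1) < ‖Y ω‖}.indicator (fun ω => ‖Y ω‖ ^ 2)) m'] with ω h1 h2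
  rw [h2] at h1
  exact h1

end Vector

/-! ### Assembly of the multivariate theorem. -/

theorem sum_Icc_one_eq_sum_range {M : Type*} [AddCommMonoid M] (f : ℕ → M) (n : ℕ) :
    ∑ k ∈ Finset.Icc 1 n, f k = ∑ k ∈ Finset.range n, f (k + 1) := by
  rw [Finset.range_eq_Ico, Finset.sum_Ico_add' f 0 n 1]
  rfl

theorem mainTheorem5 {Ω : Type*} {m : MeasurableSpace Ω} (μ : Measure Ω) [IsProbabilityMeasure μ]
    {d : ℕ} (F : ℕ → Filtration ℕ m) (X : ℕ → ℕ → Ω → EuclideanSpace ℝ (Fin d))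
    (Υ : Matrix (Fin d) (Fin d) ℝ)
    (hX : IsMartingaleDifferenceArray μ F X)
    (hsq : ∀ n k, 1 ≤ k → k ≤ n → MemLp (X n k) 2 μ)
    (hLindeberg : ConditionalLindeberg μ F X)
    (hcov : MatrixTendstoInProbability μ
      (fun n ω => ∑ k ∈ Finset.Icc 1 n, condSecondMoment μ (F n (k - 1)) (X n k) ω) Υ) :
    Υ.PosSemidef ∧
      TendstoInDistribution (fun n ω => ∑ k ∈ Finset.Icc 1 n, X n k ω) atTop
        (id : EuclideanSpace ℝ (Fin d) → EuclideanSpace ℝ (Fin d)) (fun _ => μ)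
        (multivariateGaussian 0 Υ) := by
  -- After the index shift, `X n (k + 1)` is conditioned on `F n k`.
  simp only [MatrixTendstoInProbability, ConditionalLindeberg, sum_Icc_one_eq_sum_range,
    Nat.add_sub_cancel] at hcov hLindeberg ⊢
  have hsq' : ∀ n, ∀ k < n, MemLp (X n (k + 1)) 2 μ := fun n k hk => hsq n (k + 1) (by omega) hk
  have hV (t : EuclideanSpace ℝ (Fin d)) : TendstoInMeasure μ (fun n ω => ∑ k ∈ Finset.range n,
      (μ[fun ω => inner ℝ (X n (k + 1) ω) t ^ 2 | F n k]) ω) atTop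
      fun _ => t.ofLp ⬝ᵥ Υ.mulVec t.ofLp := by
    have h := tendstoInMeasure_sum_mul (μ := μ) Finset.univ
      (fun p : Fin d × Fin d => t p.1 * t p.2) (fun p => Υ p.1 p.2)
      (f := fun p n ω => (∑ k ∈ Finset.range n,
        condSecondMoment μ (F n k) (X n (k + 1)) ω) p.1 p.2) fun p => hcov p.1 p.2
    simp only [← dotProduct_mulVec_eq_sum] at h
    refine h.congr_left fun n => ?_
    have h1 : ∀ᵐ ω ∂μ, ∀ k ∈ Finset.range n,
        (μ[fun ω => inner ℝ (X n (k + 1) ω) t ^ 2 | F n k]) ω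
          = t.ofLp ⬝ᵥ (condSecondMoment μ (F n k) (X n (k + 1)) ω).mulVec t.ofLp := by
      rw [Finset.eventually_all]
      exact fun k hk => condExp_inner_sq (hsq' n k (Finset.mem_range.1 hk)) t
    filter_upwards [h1] with ω h1
    rw [Finset.sum_congr rfl h1, Matrix.sum_mulVec, dotProduct_sum]
  have hnonneg (t : EuclideanSpace ℝ (Fin d)) : 0 ≤ t.ofLp ⬝ᵥ Υ.mulVec t.ofLp := by
    refine const_nonneg_of_tendstoInMeasure (μ := μ) (fun n => ?_) (hV t)
    have h1 : ∀ᵐ ω ∂μ, ∀ k ∈ Finset.range n,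
        0 ≤ (μ[fun ω => inner ℝ (X n (k + 1) ω) t ^ 2 | F n k]) ω := by
      rw [Finset.eventually_all]
      exact fun k hk => condExp_nonneg (ae_of_all _ fun ω => sq_nonneg _)
    filter_upwards [h1] with ω h1 using Finset.sum_nonneg h1
  have hsymm : Υ.IsHermitian := by
    ext i j
    simp only [Matrix.conjTranspose_apply, star_trivial]
    have hij : ∀ n ω, (∑ k ∈ Finset.range n, condSecondMoment μ (F n k) (X n (k + 1)) ω) i j
        = (∑ k ∈ Finset.range n, condSecondMoment μ (F n k) (X n (k + 1)) ω) j i := by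
      intro n ω
      simp only [Matrix.sum_apply, condSecondMoment, Matrix.of_apply, Matrix.vecMulVec_apply]
      simp only [mul_comm]
    -- The (i, j) and (j, i) sums are the same random variable, and limits in probability are almost
    -- surely unique.
    have h1 := hcov i j
    simp only [hij] at h1
    obtain ⟨ω, h⟩ := (tendstoInMeasure_ae_unique (hcov j i) h1).exists
    exact h
  have hpos : Υ.PosSemidef :=
    Matrix.posSemidef_iff_dotProduct_mulVec.2 ⟨hsymm, fun x => by
      simpa using hnonneg (WithLp.toLp 2 x)⟩
  have hSm : ∀ n, AEMeasurable (fun ω => ∑ k ∈ Finset.range n, X n (k + 1) ω) μ := fun n =>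
    Finset.aemeasurable_fun_sum _ fun k hk =>
      (hsq' n k (Finset.mem_range.1 hk)).aestronglyMeasurable.aemeasurable
  refine ⟨hpos, hSm, aemeasurable_id, ProbabilityMeasure.tendsto_iff_tendsto_charFun.2 fun t => ?_⟩
  have hscalar := tendsto_integral_cexp_sum_of_conditionalLindeberg (μ := μ) F
    (x := fun n k ω => inner ℝ (X n (k + 1) ω) t)
    (fun n k hk => (hX.adapted n (k + 1) (by omega) hk).inner stronglyMeasurable_const)
    (fun n k hk => (hsq' n k hk).inner_const t)
    (fun n k hk => condExp_inner_eq_zero (hX.integrable n (k + 1) (by omega) hk)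
      (by simpa using hX.condExp_eq_zero n (k + 1) (by omega) hk) t)
    -- The marginal Lindeberg sum is nonnegative, so the one-sided domination by the vector sum also
    -- bounds its absolute value.
    (hnonneg t) (hV t) (fun ε hε => by
      refine tendstoInMeasure_of_abs_sub_le_mul (C := (‖t‖ + 1) ^ 2) (by positivity) (fun n => ?_)
        (hLindeberg (ε / (‖t‖ + 1)) (by positivity))
      have h1 : ∀ᵐ ω ∂μ, ∀ k ∈ Finset.range n,
          (μ[{ω | ε < |inner ℝ (X n (k + 1) ω) t|}.indicator
            (fun ω => inner ℝ (X n (k + 1) ω) t ^ 2) | F n k]) ω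
          ≤ (‖t‖ + 1) ^ 2 * (μ[{ω | ε / (‖t‖ + 1) < ‖X n (k + 1) ω‖}.indicator
            (fun ω => ‖X n (k + 1) ω‖ ^ 2) | F n k]) ω
          ∧ 0 ≤ (μ[{ω | ε < |inner ℝ (X n (k + 1) ω) t|}.indicator
            (fun ω => inner ℝ (X n (k + 1) ω) t ^ 2) | F n k]) ω := by
        rw [Finset.eventually_all]
        exact fun k hk => (condExp_indicator_inner_sq_le (m' := F n k)
          (hsq' n k (Finset.mem_range.1 hk)) t ε).and (condExp_nonneg (m := F n k)
            (f := {ω | ε < |inner ℝ (X n (k + 1) ω) t|}.indicator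
              (fun ω => inner ℝ (X n (k + 1) ω) t ^ 2))
            (ae_of_all μ fun ω => Set.indicator_nonneg (fun ω _ => sq_nonneg _) ω))
      filter_upwards [h1] with ω h1
      rw [sub_zero, sub_zero, abs_of_nonneg (Finset.sum_nonneg fun k hk => (h1 k hk).2)]
      refine (Finset.sum_le_sum fun k hk => (h1 k hk).1).trans ?_
      rw [← Finset.mul_sum]
      exact mul_le_mul_of_nonneg_left (le_abs_self _) (by positivity))
  have hlim : charFun ((multivariateGaussian 0 Υ).map id) t
      = (Real.exp (-(t.ofLp ⬝ᵥ Υ.mulVec t.ofLp / 2)) : ℝ) := by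
    rw [Measure.map_id, charFun_multivariateGaussian hpos]
    simp
  refine (hlim ▸ hscalar).congr fun n => ?_
  change _ = charFun (μ.map fun ω => ∑ k ∈ Finset.range n, X n (k + 1) ω) t
  rw [charFun_apply, integral_map (hSm n) (by fun_prop)]
  refine integral_congr_ae (ae_of_all _ fun ω => ?_)
  simp only [sum_inner, mul_comm Complex.I]
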